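/- **Setting.** Let $\mathcal B$ be a model of synthetic differential geometry in the following sense: $\mathcal B$ is a locally Cartesian closed category with finite limits, images and countable coproducts (for instance a Grothendieck topos), with a commutative ring object $R$ which satisfies the Kock–Lawvere axiom. Here $D_k(n)\subseteq R^n$ is the subobject of those $d$ for which every product of $k+1$ coordinates $d_i$ is zero, and the axiom says, in the internal sense (with parameters from any object of $\mathcal B$), that for all $k,n$ every map $D_k(n)\to R$ is given by a unique polynomial of degree $\le k$ with coefficients in $R$. *Neighbourhoods of the diagonal.* For $B\in\mathcal B$ and $k\ge 0$ let $B_{(k)}\subseteq B\times B$ be the image of $\coprod_n D_k(n)\times B^{D_k(n)}\to B\times B$, $(\delta,f)\mapsto (f(0),f(\delta))$. Let $d,c:B_{(k)}\to B$ be the restrictions of the first and second projection, and write $\mathfrak M_k(b)$ for the fibre of $d$ over $b$, regarded as a subobject of $B$ through $c$. The $k$-jet functor on the slice $\mathcal B/B$ is $$J^k_B=\Pi_d\circ c^*:\mathcal B/B\to\mathcal B/B ,$$ where $\Pi_d$ is right adjoint to $d^*$ (so an element of $J^k_B(E)$ over $b$ is a partial section of $E\to B$ defined on $\mathfrak M_k(b)$).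 *Comorphisms.* Let $(\mathcal B^2)^*\to\mathcal B$ be the fibrewise dual of the codomain fibration. Its objects are the arrows of $\mathcal B$. An arrow over $\alpha:A\to B$ from $x:X\to A$ to $y:Y\to B$ (a comorphism) is an equivalence class of pairs $(v,h)$, $v:P\to X$, $h:P\to Y$, such that $(h,\,x\circ v)$ exhibits $P$ as a pullback of $y$ along $\alpha$; pairs $(v,h)$ and $(v',h')$ are equivalent if there is an isomorphism $s:P\to P'$ with $v's=v$ and $h's=h$. Composition is composition of spans, by pullback. The fibre of $(\mathcal B^2)^*$ over $A$ is identified with $(\mathcal B/A)^{op}$ by sending $v:x'\to x$ in $\mathcal B/A$ to the comorphism $x\to x'$ represented by $(v,1)$. **Theorem.** For every $k\ge 0$: 1. There is a functor $J^k:(\mathcal B^2)^*\to(\mathcal B^2)^*$ over $\mathcal B$ whose restriction to the fibre $(\mathcal B/A)^{op}$ is $(J^k_A)^{op}$, for every $A\in\mathcal B$. In other words, the formation of $k$-jets is functorial with respect to comorphisms of bundles. 2. $B_{(k)}$ is the usual $k$-neighbour relation in every chart of a formal manifold. In detail, call $p:U\to M$ formally étale if for all $k',n$ the square formed by $U^{D_{k'}(n)}\to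 M^{D_{k'}(n)}$, $p$ and the evaluations at $0$ is a pullback. Let $M\in\mathcal B$, let $u:U\to M$ and $e:U\to R^m$ be formally étale monomorphisms, and let $x:T\to U$ and $y:T\to M$ be generalized elements. Then $(ux,y)\in M_{(k)}$ if and only if $y=uy'$ for some $y':T\to U$ with $ey'-ex\in D_k(m)$. -/

import Mathlib

open CategoryTheory Limits MonoidalCategory CartesianMonoidalCategory
open scoped CategoryTheory.CommRingObj

universe v u

namespace JetBundles

/-! ### The fibrewise dual of the codomain fibration -/

section FibrewiseDual

variable (𝓑 : Type u) [Category.{v} 𝓑]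

/-- The objects of `(𝓑²)*`: they are the objects of `𝓑²`, that is, the arrows of `𝓑`. The arrows
are the comorphisms, see `VHSpan` and the category structure below. -/
structure CodDual where
  /-- The codomain of the arrow. -/
  base : 𝓑
  /-- The domain of the arrow. -/
  total : 𝓑
  /-- The arrow itself. -/
  proj : total ⟶ base

variable {𝓑}

/-- A vh span in the codomain fibration `𝓑² ⥤ 𝓑`, from `X.total ⟶ X.base` to
`Y.total ⟶ Y.base`: an arrow `base : X.base ⟶ Y.base`, an object of `𝓑²` over `X.base` (namely
`vert ≫ X.proj : apex ⟶ X.base`) with a vertical arrow `vert` to `X`, and a Cartesian arrow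
(a pullback square) from this object to `Y`:
```
   apex --horiz--> Y.total
    | vert            |
  X.total             |
    |                 |
  X.base --base--> Y.base
```
-/
structure VHSpan (X Y : CodDual 𝓑) where
  /-- The arrow of base objects. -/
  base : X.base ⟶ Y.base
  /-- The total object of the middle bundle. -/
  apex : 𝓑
  /-- The vertical part. -/
  vert : apex ⟶ X.total
  /-- The Cartesian part. -/
  horiz : apex ⟶ Y.total
  /-- The Cartesian part is a pullback square. -/
  isPullback : IsPullback horiz (vert ≫ X.proj) Y.proj base

namespace VHSpan

/-- Two vh spans over the same base arrow are equivalent if a vertical isomorphism of their middle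
bundles commutes with the vertical and with the Cartesian parts. -/
def Equivalent {X Y : CodDual 𝓑} (S T : VHSpan X Y) : Prop :=
  S.base = T.base ∧
    ∃ s : S.apex ≅ T.apex, s.hom ≫ T.vert = S.vert ∧ s.hom ≫ T.horiz = S.horiz

instance setoid (X Y : CodDual 𝓑) : Setoid (VHSpan X Y) where
  r := Equivalent
  iseqv :=
    { refl := fun S => ⟨rfl, Iso.refl _, by simp, by simp⟩
      symm := by
        rintro S T ⟨h, s, h1, h2⟩
        exact ⟨h.symm, s.symm, by simp [← h1], by simp [← h2]⟩
      trans := by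
        rintro S T U ⟨h, s, h1, h2⟩ ⟨h', s', h1', h2'⟩
        exact ⟨h.trans h', s ≪≫ s', by simp [h1, h1'], by simp [h2, h2']⟩ }

/-- The vh span given by identities. -/
def id (X : CodDual 𝓑) : VHSpan X X where
  base := 𝟙 _
  apex := X.total
  vert := 𝟙 _
  horiz := 𝟙 _
  isPullback := by simpa using IsPullback.of_horiz_isIso ⟨by simp⟩

/-- Composition of vh spans is the composition of spans, by a pullback. -/
noncomputable def comp [HasPullbacks 𝓑] {X Y Z : CodDual 𝓑} (S : VHSpan X Y) (T : VHSpan Y Z) :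
    VHSpan X Z where
  base := S.base ≫ T.base
  apex := pullback S.horiz T.vert
  vert := pullback.fst _ _ ≫ S.vert
  horiz := pullback.snd _ _ ≫ T.horiz
  isPullback := by
    have h := (IsPullback.of_hasPullback S.horiz T.vert).flip.paste_vert S.isPullback
    rw [Category.assoc]
    exact h.paste_horiz T.isPullback

end VHSpan

/-- A vertical arrow between the middle bundles which commutes with the two parts is
automatically an isomorphism. -/
theorem VHSpan.equivalent_of_hom {X Y : CodDual 𝓑} {S T : VHSpan X Y} (h : S.base = T.base)
    (s : S.apex ⟶ T.apex) (h1 : s ≫ T.vert = S.vert) (h2 : s ≫ T.horiz = S.horiz) :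
    S.Equivalent T := by
  refine ⟨h, ⟨s, S.isPullback.lift T.horiz (T.vert ≫ X.proj) (by rw [T.isPullback.w, h]),
    ?_, ?_⟩, h1, h2⟩
  · apply S.isPullback.hom_ext
    · rw [Category.assoc, S.isPullback.lift_fst, h2, Category.id_comp]
    · rw [Category.assoc, S.isPullback.lift_snd, reassoc_of% h1, Category.id_comp]
  · apply T.isPullback.hom_ext
    · rw [Category.assoc, h2, S.isPullback.lift_fst, Category.id_comp]
    · rw [Category.assoc, reassoc_of% h1, S.isPullback.lift_snd, Category.id_comp]

variable [HasPullbacks 𝓑]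

theorem VHSpan.exists_assoc {P Y Q Z L : 𝓑} (a : P ⟶ Y) (b : Q ⟶ Y) (c : Q ⟶ Z) (d : L ⟶ Z) :
    ∃ s : pullback (pullback.snd a b ≫ c) d ⟶ pullback a (pullback.fst c d ≫ b),
      s ≫ pullback.fst a (pullback.fst c d ≫ b) =
        pullback.fst (pullback.snd a b ≫ c) d ≫ pullback.fst a b ∧
      s ≫ pullback.snd a (pullback.fst c d ≫ b) ≫ pullback.snd c d =
        pullback.snd (pullback.snd a b ≫ c) d := by
  refine ⟨pullback.lift (pullback.fst _ _ ≫ pullback.fst _ _)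
    (pullback.lift (pullback.fst _ _ ≫ pullback.snd _ _) (pullback.snd _ _) ?_) ?_, ?_, ?_⟩
  · rw [Category.assoc, pullback.condition]
  · rw [pullback.lift_fst_assoc, Category.assoc, Category.assoc, pullback.condition]
  · rw [pullback.lift_fst]
  · rw [pullback.lift_snd_assoc, pullback.lift_snd]

/-- The category `(𝓑²)*`, the fibrewise dual of the codomain fibration: its arrows, the
comorphisms, are the equivalence classes of vh spans. -/
noncomputable instance : Category (CodDual 𝓑) where
  Hom X Y := Quotient (VHSpan.setoid X Y)
  id X := Quotient.mk _ (VHSpan.id X)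
  comp := Quotient.map₂ VHSpan.comp (by
    rintro S S' ⟨h, s, h1, h2⟩ T T' ⟨k, t, k1, k2⟩
    refine VHSpan.equivalent_of_hom (congrArg₂ _ h k)
      (pullback.map S.horiz T.vert S'.horiz T'.vert s.hom t.hom (𝟙 _)
        (by simp [h2]) (by simp [k1])) ?_ ?_
    · dsimp only [VHSpan.comp]
      rw [pullback.lift_fst_assoc, Category.assoc, h1]
    · dsimp only [VHSpan.comp]
      rw [pullback.lift_snd_assoc, Category.assoc, k2])
  id_comp := by
    rintro X Y ⟨S⟩
    refine Quotient.sound (VHSpan.equivalent_of_hom (Category.id_comp _)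
      (pullback.snd (𝟙 X.total) S.vert) ?_ rfl)
    exact (pullback.condition (f := 𝟙 X.total) (g := S.vert)).symm
  comp_id := by
    rintro X Y ⟨S⟩
    refine Quotient.sound (VHSpan.equivalent_of_hom (Category.comp_id _)
      (pullback.fst S.horiz (𝟙 Y.total)) rfl ?_)
    exact pullback.condition (f := S.horiz) (g := 𝟙 Y.total)
  assoc := by
    rintro W X Y Z ⟨S⟩ ⟨T⟩ ⟨U⟩
    obtain ⟨s, h1, h2⟩ := VHSpan.exists_assoc S.horiz T.vert T.horiz U.vert
    refine Quotient.sound (VHSpan.equivalent_of_hom (Category.assoc _ _ _) s ?_ ?_)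
    · exact (reassoc_of% h1) S.vert
    · exact (reassoc_of% h2) U.horiz

/-- The comorphism represented by a vh span. -/
def VHSpan.toHom {X Y : CodDual 𝓑} (S : VHSpan X Y) : X ⟶ Y :=
  Quotient.mk (VHSpan.setoid X Y) S

variable (𝓑) in
/-- The fibration `(𝓑²)* ⥤ 𝓑`: it sends an arrow of `𝓑` to its codomain, and the comorphism
represented by a vh span to the base arrow of the span. -/
def CodDual.toBase : CodDual 𝓑 ⥤ 𝓑 where
  obj X := X.base
  map {X Y} := Quotient.lift (fun S : VHSpan X Y => S.base) (fun _ _ h => h.1)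
  map_comp := by rintro X Y Z ⟨S⟩ ⟨T⟩; rfl

/-- The canonical identification of the opposite of the slice `𝓑/A` with the fibre of `(𝓑²)*`
over `A`: an arrow `v : x' ⟶ x` of `𝓑/A` goes to the comorphism `x ⟶ x'` represented by the vh
span `(v, 1)`. -/
def CodDual.fibre (A : 𝓑) : (Over A)ᵒᵖ ⥤ CodDual 𝓑 where
  obj x := ⟨A, x.unop.left, x.unop.hom⟩
  map {x x'} v := VHSpan.toHom
    { base := 𝟙 A
      apex := x'.unop.left
      vert := v.unop.left
      horiz := 𝟙 _
      isPullback := by simpa using IsPullback.of_horiz_isIso ⟨by simp⟩ }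
  map_id x := rfl
  map_comp {x y z} f g := by
    refine Quotient.sound ⟨by simp [VHSpan.comp],
      (asIso (pullback.snd (𝟙 y.unop.left) g.unop.left)).symm, ?_, ?_⟩
    · dsimp [VHSpan.comp]
      rw [IsIso.inv_comp_eq, ← Category.assoc, ← pullback.condition, Category.assoc]
      simp
    · simp [VHSpan.comp]

end FibrewiseDual

/-! ### Infinitesimal objects and the Kock-Lawvere axiom -/

section Infinitesimal

variable {𝓑 : Type u} [Category.{v} 𝓑] [CartesianMonoidalCategory 𝓑] [BraidedCategory 𝓑]

/-- An `n`-tuple of generalized elements of `R`, at the same stage `T`, satisfies the equations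
of the infinitesimal object `D_k(n) = {d ∈ Rⁿ | every product of k + 1 of the dᵢ is zero}`. -/
def IsInfinitesimal {R : 𝓑} [CommRingObj R] (k : ℕ) {n : ℕ} {T : 𝓑} (r : Fin n → (T ⟶ R)) : Prop :=
  ∀ g : Fin (k + 1) → Fin n, ∏ j, r (g j) = 0

variable [HasFiniteLimits 𝓑]

/-- The object `Rⁿ`. -/
noncomputable abbrev affineSpace (R : 𝓑) (n : ℕ) : 𝓑 :=
  ∏ᶜ fun _ : Fin n => R

variable (R : 𝓑) [CommRingObj R]

instance hasProduct_of_fun {k n : ℕ} (F : (Fin (k + 1) → Fin n) → 𝓑) : HasProduct F :=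
  have : HasProductsOfShape (Fin (k + 1) → Fin n) 𝓑 := hasLimitsOfShape_discrete 𝓑 _
  inferInstanceAs (HasLimit (Discrete.functor F))

/-- Precomposition with an arrow, as a ring homomorphism between rings of generalized elements
of `R`. -/
def precomp {S T : 𝓑} (f : S ⟶ T) : (T ⟶ R) →+* (S ⟶ R) :=
  ((yonedaCommRingObj R).map f.op).hom

/-- The infinitesimal object `D_k(n) ⊆ Rⁿ`: those `d` such that every product of `k + 1` of the
coordinates of `d` is zero. -/
noncomputable def infinitesimal (k n : ℕ) : 𝓑 :=
  equalizer
    (Pi.lift fun g : Fin (k + 1) → Fin n => ∏ j, Pi.π (fun _ : Fin n => R) (g j))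
    (Pi.lift fun _ : Fin (k + 1) → Fin n => (0 : affineSpace R n ⟶ R))

/-- The `i`-th coordinate on `D_k(n)`. -/
noncomputable def infinitesimal.coord (k n : ℕ) (i : Fin n) : infinitesimal R k n ⟶ R :=
  equalizer.ι _ _ ≫ Pi.π _ i

/-- The zero element of `D_k(n)`, at any stage `T`. -/
noncomputable def infinitesimal.zero (k n : ℕ) (T : 𝓑) : T ⟶ infinitesimal R k n :=
  equalizer.lift (Pi.lift fun _ => 0) (by
    refine Pi.hom_ext _ _ fun g => ?_
    rw [Category.assoc, Category.assoc, Pi.lift_π, Pi.lift_π]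
    change precomp R _ _ = precomp R _ _
    rw [map_prod, map_zero]
    refine Finset.prod_eq_zero (Finset.mem_univ (0 : Fin (k + 1))) ?_
    exact Pi.lift_π _ _)

/-- The exponents `m` of the monomials of degree at most `k` in `n` variables. -/
abbrev Exponents (k n : ℕ) : Type :=
  {m : Fin n → Fin (k + 1) // ∑ i, (m i : ℕ) ≤ k}

/-- The Kock-Lawvere axiom for the commutative ring object `R`: every map `D_k(n) ⟶ R` is given by
a unique polynomial of degree at most `k` with coefficients in `R`. As this is meant in the
internal sense, both the map and the coefficients may depend on a parameter in an object `T`. -/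
def KockLawvere : Prop :=
  ∀ (k n : ℕ) (T : 𝓑) (f : infinitesimal R k n ⊗ T ⟶ R),
    ∃! a : Exponents k n → (T ⟶ R),
      f = ∑ m, (snd _ _ ≫ a m) * ∏ i, (fst _ _ ≫ infinitesimal.coord R k n i) ^ (m.1 i : ℕ)

/-- An arrow `p : U ⟶ M` is formally étale if, for all `k` and `n`, the square formed by
`U^{D_k(n)} ⟶ M^{D_k(n)}`, `p`, and the evaluations at `0` is a pullback: in terms of generalized
elements, a map `D_k(n) ⟶ M` lifts uniquely along `p` as soon as its value at `0` is lifted. -/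
def IsFormallyEtale {U M : 𝓑} (p : U ⟶ M) : Prop :=
  ∀ (k n : ℕ) (T : 𝓑) (x : T ⟶ U) (f : infinitesimal R k n ⊗ T ⟶ M),
    lift (infinitesimal.zero R k n T) (𝟙 T) ≫ f = x ≫ p →
      ∃! g : infinitesimal R k n ⊗ T ⟶ U,
        g ≫ p = f ∧ lift (infinitesimal.zero R k n T) (𝟙 T) ≫ g = x

/-- A chart of `M`: an object `U` which is a formally étale subobject of `M` and a formally étale
subobject of some `Rⁿ`. The formal manifolds are the objects covered by their charts. -/
structure FormalChart (M : 𝓑) where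
  /-- The domain of the chart. -/
  dom : 𝓑
  /-- The dimension of the chart. -/
  dim : ℕ
  /-- The inclusion of the domain. -/
  incl : dom ⟶ M
  /-- The coordinates. -/
  coords : dom ⟶ affineSpace R dim
  mono_incl : Mono incl
  mono_coords : Mono coords
  etale_incl : IsFormallyEtale R incl
  etale_coords : IsFormallyEtale R coords

end Infinitesimal

/-! ### The neighbourhoods of the diagonal and the jet functors -/

section Jets

variable {𝓑 : Type u} [Category.{v} 𝓑] [CartesianMonoidalCategory 𝓑] [BraidedCategory 𝓑]
  [HasFiniteLimits 𝓑] [MonoidalClosed 𝓑] [HasImages 𝓑] [HasCoproductsOfShape ℕ 𝓑]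
  (R : 𝓑) [CommRingObj R]

/-- The map which sends a pair `(d, f)` of `d ∈ D_k(n)` and `f : D_k(n) ⟶ B`, for any `n`, to the
pair `(f 0, f d)`. -/
noncomputable def endpoints (k : ℕ) (B : 𝓑) :
    (∐ fun n : ℕ => infinitesimal R k n ⊗ (ihom (infinitesimal R k n)).obj B) ⟶ B ⊗ B :=
  Sigma.desc fun n =>
    lift (lift (infinitesimal.zero R k n _) (snd _ _) ≫ (ihom.ev (infinitesimal R k n)).app B)
      ((ihom.ev (infinitesimal R k n)).app B)

/-- The `k`-th neighbourhood of the diagonal `B_(k) ⊆ B × B`: it consists of the pairs `(b, b')`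
which are of the form `(f 0, f d)` for some `n`, `f : D_k(n) ⟶ B` and `d ∈ D_k(n)`. -/
noncomputable abbrev nbhd (k : ℕ) (B : 𝓑) : 𝓑 :=
  image (endpoints R k B)

/-- The inclusion `B_(k) ⟶ B × B`. -/
noncomputable abbrev nbhd.ι (k : ℕ) (B : 𝓑) : nbhd R k B ⟶ B ⊗ B :=
  image.ι (endpoints R k B)

/-- The generalized elements `x` and `y` of `B` satisfy `(x, y) ∈ B_(k)`, that is,
`y ∈ 𝔐_k(x)`. -/
def IsNeighbour (k : ℕ) {B T : 𝓑} (x y : T ⟶ B) : Prop :=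
  ∃ z : T ⟶ nbhd R k B, z ≫ nbhd.ι R k B = lift x y

/-- The first projection `(b, b') ↦ b` on `B_(k)`; its fibre over `b` is `𝔐_k(b)`. -/
noncomputable def nbhd.d (k : ℕ) (B : 𝓑) : nbhd R k B ⟶ B :=
  nbhd.ι R k B ≫ fst _ _

/-- The second projection `(b, b') ↦ b'` on `B_(k)`; on the fibre `𝔐_k(b)` of `nbhd.d`, it is the
inclusion into `B`. -/
noncomputable def nbhd.c (k : ℕ) (B : 𝓑) : nbhd R k B ⟶ B :=
  nbhd.ι R k B ≫ snd _ _

/-- A category with pullbacks is locally Cartesian closed if every pullback functor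
`f^* : 𝓑/Y ⥤ 𝓑/X` has a right adjoint `Π_f`. -/
class LocallyCartesianClosed (𝓑 : Type u) [Category.{v} 𝓑] [HasPullbacks 𝓑] : Prop where
  isLeftAdjoint {X Y : 𝓑} (f : X ⟶ Y) : (Over.pullback f).IsLeftAdjoint

attribute [instance] LocallyCartesianClosed.isLeftAdjoint

/-- The `k`-jet functor `J^k_B = Π_d ∘ c^* : 𝓑/B ⥤ 𝓑/B`. -/
noncomputable def jet [LocallyCartesianClosed 𝓑] (k : ℕ) (B : 𝓑) : Over B ⥤ Over B :=
  Over.pullback (nbhd.c R k B) ⋙ (Over.pullback (nbhd.d R k B)).rightAdjoint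

end Jets

end JetBundles

/-! Functoriality. An arrow `α : A ⟶ B` carries a figure `f` on `D_k(n)` to the figure `α ∘ f`, so
it maps `A_(k)` to `B_(k)` (`nbhd.map`), and `𝔐_k(a)` to `𝔐_k(α a)`. Given a comorphism `(v, h)`
over `α` from `X` to `Y`, a jet of `Y` at `α a` restricts along this map. The pullback property
turns its values into a section of the middle bundle over `𝔐_k(a)`, and `v` pushes that to a jet of
`X` at `a`. This gives an arrow from the pullback along `α` of the jets of `Y` to the jets of `X`,
hence again a comorphism (`jetSpan`). The adjunction defining `jet` is used only through values of
jets at neighbours: jets with equal values are equal (`jet_hom_ext`), and partial sections are jets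
(`exists_jet`). All functor laws are then checked on values by `equivalent_jetSpan`.

Charts. By Kock–Lawvere a function on `D_k(n)` is a polynomial, so its variation between `0` and `d`
lies in the ideal generated by the coordinates of `d`, and products of `k + 1` such variations
vanish (`KockLawvere.isInfinitesimal_sub`). A figure in `M` starting in `U` lifts to `U`, so its
endpoints differ by an element of `D_k(m)` in coordinates. Since `M_(k)` is an image, this is proved
for figures and extended by minimality of the image; for that the property must be a subobject of `M
× M`, which universal quantification along `U × M ⟶ M × M` provides. Conversely, the translate `d ↦
e x + d` lifts along the étale map `e` to a figure joining `x` to `y`. -/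

namespace JetBundles

/-! ### Generalized elements of `D_k(n)` -/

section InfinitesimalObject

variable {𝓑 : Type u} [Category.{v} 𝓑] [CartesianMonoidalCategory 𝓑] [BraidedCategory 𝓑]
  [HasFiniteLimits 𝓑] (R : 𝓑) [CommRingObj R]

variable {R} in
omit [HasFiniteLimits 𝓑] in
theorem IsInfinitesimal.comp {k n : ℕ} {S T : 𝓑} {r : Fin n → (T ⟶ R)}
    (h : IsInfinitesimal k r) (f : S ⟶ T) : IsInfinitesimal k fun i => f ≫ r i := fun g => by
  change ∏ j, precomp R f (r (g j)) = 0
  rw [← map_prod, h g, map_zero]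

theorem infinitesimal.hom_ext {k n : ℕ} {T : 𝓑} {f g : T ⟶ infinitesimal R k n}
    (h : ∀ i, f ≫ coord R k n i = g ≫ coord R k n i) : f = g :=
  equalizer.hom_ext (Pi.hom_ext _ _ fun i =>
    (Category.assoc _ _ _).trans ((h i).trans (Category.assoc _ _ _).symm))

theorem infinitesimal.zero_coord (k n : ℕ) (T : 𝓑) (i : Fin n) :
    zero R k n T ≫ coord R k n i = 0 :=
  ((Category.assoc _ _ _).symm.trans (congrArg (· ≫ Pi.π _ i) (equalizer.lift_ι _ _))).trans
    (Pi.lift_π _ _)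

theorem infinitesimal.comp_zero (k n : ℕ) {S T : 𝓑} (f : S ⟶ T) :
    f ≫ zero R k n T = zero R k n S :=
  hom_ext R fun i => by
    rw [Category.assoc, zero_coord, zero_coord]
    exact map_zero (precomp R f)

theorem infinitesimal.isInfinitesimal_coord (k n : ℕ) :
    IsInfinitesimal k (coord R k n) := fun g => by
  have h := congrArg (· ≫ Pi.π _ g) (equalizer.condition
    (Pi.lift fun g : Fin (k + 1) → Fin n => ∏ j, Pi.π (fun _ : Fin n => R) (g j))
    (Pi.lift fun _ : Fin (k + 1) → Fin n => (0 : affineSpace R n ⟶ R)))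
  simp only [Category.assoc, Pi.lift_π] at h
  have h' : precomp R (equalizer.ι _ _) _ = precomp R (equalizer.ι _ _) _ := h
  rw [map_prod, map_zero] at h'
  exact h'

variable {R} in
theorem IsInfinitesimal.exists_lift {k n : ℕ} {T : 𝓑} {r : Fin n → (T ⟶ R)}
    (h : IsInfinitesimal k r) :
    ∃ δ : T ⟶ infinitesimal R k n, ∀ i, δ ≫ infinitesimal.coord R k n i = r i := by
  refine ⟨equalizer.lift (Pi.lift r) (Pi.hom_ext _ _ fun g => ?_), fun i => ?_⟩
  · rw [Category.assoc, Category.assoc, Pi.lift_π, Pi.lift_π]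
    change precomp R _ _ = precomp R _ _
    rw [map_prod, map_zero, ← h g]
    exact Finset.prod_congr rfl fun j _ => Pi.lift_π _ _
  · exact ((Category.assoc _ _ _).symm.trans
      (congrArg (· ≫ Pi.π _ i) (equalizer.lift_ι _ _))).trans (Pi.lift_π _ _)

end InfinitesimalObject

/-! ### Neighbourhoods of the diagonal and their functoriality -/

section Neighbourhoods

variable {𝓑 : Type u} [Category.{v} 𝓑] [CartesianMonoidalCategory 𝓑] [BraidedCategory 𝓑]
  [HasFiniteLimits 𝓑] [MonoidalClosed 𝓑] [HasImages 𝓑] [HasCoproductsOfShape ℕ 𝓑]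
  (R : 𝓑) [CommRingObj R] (k : ℕ)

omit [HasImages 𝓑] in
theorem ι_endpoints (B : 𝓑) (n : ℕ) :
    Sigma.ι (fun n : ℕ => infinitesimal R k n ⊗ (ihom (infinitesimal R k n)).obj B) n ≫
        endpoints R k B =
      lift (lift (infinitesimal.zero R k n _) (snd _ _) ≫ (ihom.ev (infinitesimal R k n)).app B)
        ((ihom.ev (infinitesimal R k n)).app B) :=
  Sigma.ι_desc _ _

/-- The image of `endpoints` lies in a subobject as soon as the components of `endpoints` do. -/
theorem exists_nbhd_lift {B S : 𝓑} (m : S ⟶ B ⊗ B) [Mono m]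
    (h : ∀ n : ℕ, ∃ e : infinitesimal R k n ⊗ (ihom (infinitesimal R k n)).obj B ⟶ S,
      e ≫ m =
        lift (lift (infinitesimal.zero R k n _) (snd _ _) ≫ (ihom.ev (infinitesimal R k n)).app B)
          ((ihom.ev (infinitesimal R k n)).app B)) :
    ∃ l : nbhd R k B ⟶ S, l ≫ m = nbhd.ι R k B := by
  choose e he using h
  let F : MonoFactorisation (endpoints R k B) :=
    { I := S
      m := m
      e := Sigma.desc e
      fac := Sigma.hom_ext _ _ fun n => by rw [Sigma.ι_desc_assoc, he, ι_endpoints] }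
  exact ⟨image.lift F, image.lift_fac F⟩

/-- The endpoints of an infinitesimal figure are neighbours. -/
theorem isNeighbour_endpoints {B T : 𝓑} (n : ℕ) (f : infinitesimal R k n ⊗ T ⟶ B)
    (δ : T ⟶ infinitesimal R k n) :
    IsNeighbour R k (lift (infinitesimal.zero R k n T) (𝟙 T) ≫ f) (lift δ (𝟙 T) ≫ f) := by
  have key (ε : T ⟶ infinitesimal R k n) :
      lift ε (MonoidalClosed.curry f) ≫ (ihom.ev (infinitesimal R k n)).app B =
        lift ε (𝟙 T) ≫ f := by
    have : lift ε (MonoidalClosed.curry f) =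
        lift ε (𝟙 T) ≫ (infinitesimal R k n ◁ MonoidalClosed.curry f) := by simp
    rw [this, Category.assoc, ← MonoidalClosed.uncurry_eq, MonoidalClosed.uncurry_curry]
  refine ⟨lift δ (MonoidalClosed.curry f) ≫
    Sigma.ι (fun n : ℕ => infinitesimal R k n ⊗ (ihom (infinitesimal R k n)).obj B) n ≫
      factorThruImage _, ?_⟩
  rw [Category.assoc, Category.assoc, image.fac, ι_endpoints, comp_lift, key, ← Category.assoc,
    comp_lift, infinitesimal.comp_zero, lift_snd, key]

/-- The preimage of `B_(k)` under `α × α` is a subobject of `A × A`. It contains the endpoints of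
every figure `f` in `A`, because `α ∘ f` is a figure in `B`; by minimality it contains `A_(k)`. -/
theorem exists_nbhd_map {A B : 𝓑} (α : A ⟶ B) :
    ∃ m : nbhd R k A ⟶ nbhd R k B, m ≫ nbhd.ι R k B = nbhd.ι R k A ≫ (α ⊗ₘ α) := by
  obtain ⟨l, hl⟩ := exists_nbhd_lift R k (pullback.fst (α ⊗ₘ α) (nbhd.ι R k B)) fun n =>
    ⟨pullback.lift
      (lift (lift (infinitesimal.zero R k n _) (snd _ _) ≫ (ihom.ev (infinitesimal R k n)).app A)
        ((ihom.ev (infinitesimal R k n)).app A))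
      (infinitesimal R k n ◁ (ihom (infinitesimal R k n)).map α ≫
        Sigma.ι (fun n : ℕ => infinitesimal R k n ⊗ (ihom (infinitesimal R k n)).obj B) n ≫
          factorThruImage _) (by
      rw [Category.assoc, Category.assoc, image.fac, ι_endpoints, lift_map, comp_lift]
      have nat := ihom.ev_naturality (infinitesimal R k n) α
      rw [nat, Category.assoc, ← nat, ← Category.assoc, ← Category.assoc, comp_lift,
        infinitesimal.comp_zero]
      simp), by rw [pullback.lift_fst]⟩
  exact ⟨l ≫ pullback.snd _ _, by rw [Category.assoc, ← pullback.condition, reassoc_of% hl]⟩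

/-- The arrow `A_(k) ⟶ B_(k)` induced by an arrow `A ⟶ B`. -/
noncomputable def nbhd.map {A B : 𝓑} (α : A ⟶ B) : nbhd R k A ⟶ nbhd R k B :=
  (exists_nbhd_map R k α).choose

theorem nbhd.map_ι {A B : 𝓑} (α : A ⟶ B) :
    nbhd.map R k α ≫ nbhd.ι R k B = nbhd.ι R k A ≫ (α ⊗ₘ α) :=
  (exists_nbhd_map R k α).choose_spec

theorem nbhd.map_d {A B : 𝓑} (α : A ⟶ B) :
    nbhd.map R k α ≫ nbhd.d R k B = nbhd.d R k A ≫ α := by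
  simp [nbhd.d, reassoc_of% nbhd.map_ι R k α]

theorem nbhd.map_c {A B : 𝓑} (α : A ⟶ B) :
    nbhd.map R k α ≫ nbhd.c R k B = nbhd.c R k A ≫ α := by
  simp [nbhd.c, reassoc_of% nbhd.map_ι R k α]

theorem nbhd.map_id (A : 𝓑) : nbhd.map R k (𝟙 A) = 𝟙 _ := by
  rw [← cancel_mono (nbhd.ι R k A), nbhd.map_ι]
  simp

theorem nbhd.map_comp {A B C : 𝓑} (α : A ⟶ B) (β : B ⟶ C) :
    nbhd.map R k (α ≫ β) = nbhd.map R k α ≫ nbhd.map R k β := by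
  rw [← cancel_mono (nbhd.ι R k C), nbhd.map_ι, Category.assoc, nbhd.map_ι,
    reassoc_of% nbhd.map_ι R k α]
  simp

end Neighbourhoods

/-! ### Jets as partial sections: evaluation, extensionality, existence -/

section JetEvaluation

variable {𝓑 : Type u} [Category.{v} 𝓑] [CartesianMonoidalCategory 𝓑] [BraidedCategory 𝓑]
  [HasFiniteLimits 𝓑] [MonoidalClosed 𝓑] [HasImages 𝓑] [HasCoproductsOfShape ℕ 𝓑]
  [LocallyCartesianClosed 𝓑] {R : 𝓑} [CommRingObj R] {k : ℕ}

/-- The universal property of the jet functor, as the composite of `c^*` and the right adjoint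
of `d^*`. -/
noncomputable def jetEquiv {B : 𝓑} (t E : Over B) :
    (t ⟶ (jet R k B).obj E) ≃
      ((Over.pullback (nbhd.d R k B)).obj t ⟶ (Over.pullback (nbhd.c R k B)).obj E) :=
  ((Adjunction.ofIsLeftAdjoint (Over.pullback (nbhd.d R k B))).homEquiv _ _).symm

theorem jetEquiv_comp {B : 𝓑} {t t' E : Over B} (f : t ⟶ t') (j : t' ⟶ (jet R k B).obj E) :
    jetEquiv t E (f ≫ j) = (Over.pullback (nbhd.d R k B)).map f ≫ jetEquiv t' E j :=
  Adjunction.homEquiv_naturality_left_symm _ _ _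

theorem jetEquiv_comp_map {B : 𝓑} {t E F : Over B} (j : t ⟶ (jet R k B).obj E) (f : E ⟶ F) :
    jetEquiv t F (j ≫ (jet R k B).map f) =
      jetEquiv t E j ≫ (Over.pullback (nbhd.c R k B)).map f :=
  Adjunction.homEquiv_naturality_right_symm _ _ _

/-- The universal evaluation of jets. -/
noncomputable def jetCounit {B : 𝓑} (E : Over B) :
    pullback ((jet R k B).obj E).hom (nbhd.d R k B) ⟶ E.left :=
  (jetEquiv _ E (𝟙 ((jet R k B).obj E))).left ≫ pullback.fst E.hom (nbhd.c R k B)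

/-- Yoneda: by naturality in `t`, every transpose is the transpose of the identity precomposed with
`j`. Evaluation thus determines the whole adjunction. -/
theorem jetEquiv_left_fst {B : 𝓑} {t E : Over B} (j : t ⟶ (jet R k B).obj E) :
    (jetEquiv t E j).left ≫ pullback.fst E.hom (nbhd.c R k B) =
      pullback.lift (pullback.fst t.hom (nbhd.d R k B) ≫ j.left)
        (pullback.snd t.hom (nbhd.d R k B))
        (by rw [Category.assoc, Over.w, pullback.condition]) ≫ jetCounit E := by
  have h := jetEquiv_comp j (𝟙 ((jet R k B).obj E))
  rw [Category.comp_id] at h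
  rw [h, Over.comp_left, Category.assoc]
  rfl

theorem jetEquiv_left_snd {B : 𝓑} {t E : Over B} (j : t ⟶ (jet R k B).obj E) :
    (jetEquiv t E j).left ≫ pullback.snd E.hom (nbhd.c R k B) =
      pullback.snd t.hom (nbhd.d R k B) :=
  Over.w (jetEquiv t E j)

theorem jetCounit_hom {B : 𝓑} (E : Over B) :
    jetCounit (R := R) (k := k) E ≫ E.hom = pullback.snd _ _ ≫ nbhd.c R k B := by
  rw [jetCounit, Category.assoc, pullback.condition, ← Category.assoc, jetEquiv_left_snd]

theorem jetCounit_naturality {B : 𝓑} {E F : Over B} (f : E ⟶ F) :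
    pullback.lift (pullback.fst _ _ ≫ ((jet R k B).map f).left) (pullback.snd _ _)
      (by rw [Category.assoc, Over.w, pullback.condition]) ≫ jetCounit F =
      jetCounit (R := R) (k := k) E ≫ f.left := by
  have h := jetEquiv_comp_map (𝟙 ((jet R k B).obj E)) f
  rw [Category.id_comp] at h
  rw [← jetEquiv_left_fst, h, Over.comp_left, Category.assoc, jetCounit, Category.assoc]
  congr 1
  exact pullback.lift_fst _ _ _

/-- The value of a jet `j` at a neighbour `n` of the base point of `j`. -/
noncomputable def jetEval {B T : 𝓑} {E : Over B} (j : T ⟶ ((jet R k B).obj E).left)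
    (n : T ⟶ nbhd R k B) (h : j ≫ ((jet R k B).obj E).hom = n ≫ nbhd.d R k B) : T ⟶ E.left :=
  pullback.lift j n h ≫ jetCounit E

theorem jetEval_hom {B T : 𝓑} {E : Over B} (j : T ⟶ ((jet R k B).obj E).left)
    (n : T ⟶ nbhd R k B) (h : j ≫ ((jet R k B).obj E).hom = n ≫ nbhd.d R k B) :
    jetEval j n h ≫ E.hom = n ≫ nbhd.c R k B := by
  rw [jetEval, Category.assoc, jetCounit_hom, pullback.lift_snd_assoc]

theorem comp_jetEval {B S T : 𝓑} {E : Over B} (g : S ⟶ T) (j : T ⟶ ((jet R k B).obj E).left)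
    (n : T ⟶ nbhd R k B) (h : j ≫ ((jet R k B).obj E).hom = n ≫ nbhd.d R k B) :
    g ≫ jetEval j n h =
      jetEval (g ≫ j) (g ≫ n) (by rw [Category.assoc, h, Category.assoc]) := by
  simp only [jetEval, ← Category.assoc]
  congr 1
  apply pullback.hom_ext
  · rw [Category.assoc, pullback.lift_fst, pullback.lift_fst]
  · rw [Category.assoc, pullback.lift_snd, pullback.lift_snd]

theorem jetEval_congr {B T : 𝓑} {E : Over B} {j j' : T ⟶ ((jet R k B).obj E).left}
    {n n' : T ⟶ nbhd R k B} (hj : j = j') (hn : n = n')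
    (h : j ≫ ((jet R k B).obj E).hom = n ≫ nbhd.d R k B) :
    jetEval j n h = jetEval j' n' (hj ▸ hn ▸ h) := by
  subst hj hn
  rfl

theorem jetEval_map {B T : 𝓑} {E F : Over B} (f : E ⟶ F) (j : T ⟶ ((jet R k B).obj E).left)
    (n : T ⟶ nbhd R k B) (h : j ≫ ((jet R k B).obj E).hom = n ≫ nbhd.d R k B) :
    jetEval (j ≫ ((jet R k B).map f).left) n
        (by rw [Category.assoc, Over.w, h]) = jetEval j n h ≫ f.left := by
  refine Eq.trans ?_ (Category.assoc _ _ _).symm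
  rw [← jetCounit_naturality, jetEval]
  refine Eq.trans (congrArg (· ≫ jetCounit F) ?_) (Category.assoc _ _ _)
  apply pullback.hom_ext <;>
    simp only [Category.assoc, pullback.lift_fst, pullback.lift_fst_assoc, pullback.lift_snd]

/-- Transposition is injective, and the transpose of `j` is its value at the generic neighbour of
its base point, the stage being the pullback of `nbhd.d`. -/
theorem jet_hom_ext {B T : 𝓑} {E : Over B} {j j' : T ⟶ ((jet R k B).obj E).left}
    (h : j ≫ ((jet R k B).obj E).hom = j' ≫ ((jet R k B).obj E).hom)
    (h' : ∀ (S : 𝓑) (g : S ⟶ T) (n : S ⟶ nbhd R k B)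
      (w : (g ≫ j) ≫ ((jet R k B).obj E).hom = n ≫ nbhd.d R k B)
      (w' : (g ≫ j') ≫ ((jet R k B).obj E).hom = n ≫ nbhd.d R k B),
      jetEval (g ≫ j) n w = jetEval (g ≫ j') n w') : j = j' := by
  let J : Over.mk (j ≫ ((jet R k B).obj E).hom) ⟶ (jet R k B).obj E := Over.homMk j rfl
  let J' : Over.mk (j ≫ ((jet R k B).obj E).hom) ⟶ (jet R k B).obj E := Over.homMk j' h.symm
  suffices J = J' from congrArg CommaMorphism.left this
  apply (jetEquiv _ _).injective
  ext1
  apply pullback.hom_ext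
  · rw [jetEquiv_left_fst, jetEquiv_left_fst]
    exact h' _ (pullback.fst (j ≫ ((jet R k B).obj E).hom) (nbhd.d R k B)) (pullback.snd _ _)
      (by rw [Category.assoc, pullback.condition])
      (by rw [Category.assoc, ← h, pullback.condition])
  · rw [jetEquiv_left_snd, jetEquiv_left_snd]

/-- Surjectivity of transposition: `s` is a `T`-indexed family of sections over the `𝔐_k(t)`, and
the jet obtained has `s` as its values. -/
theorem exists_jet {B T : 𝓑} {E : Over B} (t : T ⟶ B)
    (s : pullback t (nbhd.d R k B) ⟶ E.left)
    (hs : s ≫ E.hom = pullback.snd t (nbhd.d R k B) ≫ nbhd.c R k B) :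
    ∃ (j : T ⟶ ((jet R k B).obj E).left) (hj : j ≫ ((jet R k B).obj E).hom = t),
      ∀ (S : 𝓑) (g : S ⟶ T) (n : S ⟶ nbhd R k B) (w : g ≫ t = n ≫ nbhd.d R k B),
        jetEval (g ≫ j) n (by rw [Category.assoc, hj, w]) = pullback.lift g n w ≫ s := by
  let σ : (Over.pullback (nbhd.d R k B)).obj (Over.mk t) ⟶ (Over.pullback (nbhd.c R k B)).obj E :=
    Over.homMk (pullback.lift s (pullback.snd t (nbhd.d R k B)) hs) (pullback.lift_snd _ _ _)
  obtain ⟨J, hJ⟩ := (jetEquiv (Over.mk t) E).surjective σ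
  refine ⟨J.left, Over.w J, fun S g n w => ?_⟩
  have key := jetEquiv_left_fst J
  rw [hJ] at key
  have key' : s = _ := (pullback.lift_fst _ _ _).symm.trans key
  rw [key', jetEval]
  refine Eq.trans (congrArg (· ≫ jetCounit E) ?_) (Category.assoc _ _ _)
  apply pullback.hom_ext
  · simp only [Category.assoc, pullback.lift_fst]
    exact (pullback.lift_fst_assoc _ _ _ _).symm
  · simp only [Category.assoc, pullback.lift_snd]
    exact (pullback.lift_snd _ _ _).symm

end JetEvaluation

end JetBundles

namespace JetBundles

/-! ### The jet functor on comorphisms -/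

section JetFunctor

variable {𝓑 : Type u} [Category.{v} 𝓑] [CartesianMonoidalCategory 𝓑] [BraidedCategory 𝓑]
  [HasFiniteLimits 𝓑] [MonoidalClosed 𝓑] [HasImages 𝓑] [HasCoproductsOfShape ℕ 𝓑]
  [LocallyCartesianClosed 𝓑] (R : 𝓑) [CommRingObj R] (k : ℕ)

/-- The bundle of `k`-jets of a bundle, as an object of `(𝓑²)*`. -/
noncomputable abbrev jetBundle (X : CodDual 𝓑) : CodDual 𝓑 where
  base := X.base
  total := ((jet R k X.base).obj (Over.mk X.proj)).left
  proj := ((jet R k X.base).obj (Over.mk X.proj)).hom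

variable {R k} in
theorem jet_base_change {X Y : CodDual 𝓑} (α : X.base ⟶ Y.base) {T : 𝓑}
    {q : T ⟶ pullback (jetBundle R k Y).proj α} {n : T ⟶ nbhd R k X.base}
    (h : q ≫ pullback.snd _ _ = n ≫ nbhd.d R k X.base) :
    (q ≫ pullback.fst _ _) ≫ ((jet R k Y.base).obj (Over.mk Y.proj)).hom =
      (n ≫ nbhd.map R k α) ≫ nbhd.d R k Y.base := by
  rw [Category.assoc, pullback.condition, reassoc_of% h, Category.assoc, nbhd.map_d]

/-- At a neighbour `n` of `a`, the value of a jet of `Y` at the image of `n` lies over the image of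
`c n`, so with `c n` it determines a unique point `p` of the middle bundle; the value of the new jet
is the vertical image of `p`. Quantifying over all such `p` loses nothing, by uniqueness. -/
theorem exists_jetVert {X Y : CodDual 𝓑} (S : VHSpan X Y) :
    ∃ (v : pullback (jetBundle R k Y).proj S.base ⟶ (jetBundle R k X).total)
      (hv : v ≫ (jetBundle R k X).proj = pullback.snd _ _),
      ∀ (T : 𝓑) (q : T ⟶ pullback (jetBundle R k Y).proj S.base) (n : T ⟶ nbhd R k X.base)
        (h : q ≫ pullback.snd _ _ = n ≫ nbhd.d R k X.base) (p : T ⟶ S.apex),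
        p ≫ S.horiz = jetEval (q ≫ pullback.fst _ _) (n ≫ nbhd.map R k S.base)
          (jet_base_change S.base h) →
        p ≫ S.vert ≫ X.proj = n ≫ nbhd.c R k X.base →
        jetEval (E := Over.mk X.proj) (q ≫ v) n (by rw [Category.assoc, hv, h]) =
          p ≫ S.vert := by
  let π := pullback.snd (jetBundle R k Y).proj S.base
  have hπ := jet_base_change S.base (pullback.condition (f := π) (g := nbhd.d R k X.base))
  let s := S.isPullback.lift
    (jetEval (pullback.fst π (nbhd.d R k X.base) ≫ pullback.fst _ _)
      (pullback.snd π (nbhd.d R k X.base) ≫ nbhd.map R k S.base) hπ)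
    (pullback.snd π (nbhd.d R k X.base) ≫ nbhd.c R k X.base)
    ((jetEval_hom _ _ hπ).trans (by rw [Category.assoc, nbhd.map_c, Category.assoc]))
  obtain ⟨v, hv, H⟩ := exists_jet (E := Over.mk X.proj) π (s ≫ S.vert) (by
    rw [Category.assoc]; exact S.isPullback.lift_snd _ _ _)
  refine ⟨v, hv, fun T q n h p hp hp' => (H T q n h).trans ?_⟩
  rw [← Category.assoc]
  congr 1
  apply S.isPullback.hom_ext
  · rw [Category.assoc, S.isPullback.lift_fst, comp_jetEval, hp]
    exact jetEval_congr (pullback.lift_fst_assoc _ _ _ _) (pullback.lift_snd_assoc _ _ _ _) _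
  · rw [Category.assoc, S.isPullback.lift_snd, pullback.lift_snd_assoc, hp']

/-- The vertical part of the action of the jet functor on a vh span: a jet at `α a` is restricted
along `𝔐_k(a) ⟶ 𝔐_k(α a)` and composed with the vertical part of the span. -/
noncomputable def jetVert {X Y : CodDual 𝓑} (S : VHSpan X Y) :
    pullback (jetBundle R k Y).proj S.base ⟶ (jetBundle R k X).total :=
  (exists_jetVert R k S).choose

theorem jetVert_proj {X Y : CodDual 𝓑} (S : VHSpan X Y) :
    jetVert R k S ≫ (jetBundle R k X).proj = pullback.snd _ _ :=
  (exists_jetVert R k S).choose_spec.choose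

variable {R k} in
theorem comp_jetVert_proj {X Y : CodDual 𝓑} (S : VHSpan X Y) {T : 𝓑}
    {q : T ⟶ pullback (jetBundle R k Y).proj S.base} {n : T ⟶ nbhd R k X.base}
    (h : q ≫ pullback.snd _ _ = n ≫ nbhd.d R k X.base) :
    (q ≫ jetVert R k S) ≫ ((jet R k X.base).obj (Over.mk X.proj)).hom =
      n ≫ nbhd.d R k X.base := by
  rw [Category.assoc, jetVert_proj, h]

theorem jetEval_jetVert {X Y : CodDual 𝓑} (S : VHSpan X Y) {T : 𝓑}
    (q : T ⟶ pullback (jetBundle R k Y).proj S.base) (n : T ⟶ nbhd R k X.base)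
    (h : q ≫ pullback.snd _ _ = n ≫ nbhd.d R k X.base) (p : T ⟶ S.apex)
    (hp : p ≫ S.horiz = jetEval (q ≫ pullback.fst _ _) (n ≫ nbhd.map R k S.base)
      (jet_base_change S.base h))
    (hp' : p ≫ S.vert ≫ X.proj = n ≫ nbhd.c R k X.base) :
    jetEval (E := Over.mk X.proj) (q ≫ jetVert R k S) n (comp_jetVert_proj S h) = p ≫ S.vert :=
  (exists_jetVert R k S).choose_spec.choose_spec T q n h p hp hp'

theorem exists_jetEval_jetVert {X Y : CodDual 𝓑} (S : VHSpan X Y) {T : 𝓑}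
    (q : T ⟶ pullback (jetBundle R k Y).proj S.base) (n : T ⟶ nbhd R k X.base)
    (h : q ≫ pullback.snd _ _ = n ≫ nbhd.d R k X.base) :
    ∃ p : T ⟶ S.apex,
      p ≫ S.horiz = jetEval (q ≫ pullback.fst _ _) (n ≫ nbhd.map R k S.base)
        (jet_base_change S.base h) ∧
      p ≫ S.vert ≫ X.proj = n ≫ nbhd.c R k X.base ∧
      jetEval (E := Over.mk X.proj) (q ≫ jetVert R k S) n (comp_jetVert_proj S h) =
        p ≫ S.vert := by
  have w : jetEval (q ≫ pullback.fst _ _) (n ≫ nbhd.map R k S.base)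
      (jet_base_change S.base h) ≫ Y.proj = (n ≫ nbhd.c R k X.base) ≫ S.base :=
    (jetEval_hom _ _ _).trans (by rw [Category.assoc, nbhd.map_c, Category.assoc])
  exact ⟨S.isPullback.lift _ _ w, S.isPullback.lift_fst _ _ w, S.isPullback.lift_snd _ _ w,
    jetEval_jetVert R k S q n h _ (S.isPullback.lift_fst _ _ w) (S.isPullback.lift_snd _ _ w)⟩

/-- The action of the jet functor on vh spans. -/
noncomputable def jetSpan {X Y : CodDual 𝓑} (S : VHSpan X Y) :
    VHSpan (jetBundle R k X) (jetBundle R k Y) where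
  base := S.base
  apex := pullback (jetBundle R k Y).proj S.base
  vert := jetVert R k S
  horiz := pullback.fst _ _
  isPullback := by
    rw [jetVert_proj]
    exact IsPullback.of_hasPullback _ _

/-- A criterion for a vh span to be equivalent to the jet prolongation of a vh span. -/
theorem equivalent_jetSpan {X Y : CodDual 𝓑} (S : VHSpan X Y)
    (U : VHSpan (jetBundle R k X) (jetBundle R k Y)) (hb : U.base = S.base)
    (H : ∀ (T : 𝓑) (g : T ⟶ U.apex) (n : T ⟶ nbhd R k X.base)
      (w : (g ≫ U.vert) ≫ ((jet R k X.base).obj (Over.mk X.proj)).hom = n ≫ nbhd.d R k X.base)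
      (w' : (g ≫ U.horiz) ≫ ((jet R k Y.base).obj (Over.mk Y.proj)).hom =
        (n ≫ nbhd.map R k S.base) ≫ nbhd.d R k Y.base),
      ∃ p : T ⟶ S.apex,
        p ≫ S.horiz = jetEval (g ≫ U.horiz) (n ≫ nbhd.map R k S.base) w' ∧
        p ≫ S.vert = jetEval (E := Over.mk X.proj) (g ≫ U.vert) n w) :
    U.Equivalent (jetSpan R k S) := by
  let s : U.apex ⟶ pullback (jetBundle R k Y).proj S.base :=
    pullback.lift U.horiz (U.vert ≫ (jetBundle R k X).proj) (by rw [U.isPullback.w, hb])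
  -- The Cartesian part forces the comparison `s`; only its compatibility with the vertical parts
  -- has content, and that is an equality of jets, tested on values.
  have hs : s ≫ jetVert R k S = U.vert := by
    refine jet_hom_ext ?_ fun T g n w w' => ?_
    · rw [Category.assoc, jetVert_proj]
      exact pullback.lift_snd _ _ _
    · have h : (g ≫ s) ≫ pullback.snd _ _ = n ≫ nbhd.d R k X.base := by
        rw [← w, Category.assoc, Category.assoc, Category.assoc, jetVert_proj]
      have e : (g ≫ s) ≫ pullback.fst _ _ = g ≫ U.horiz := by
        rw [Category.assoc, pullback.lift_fst]
      obtain ⟨p, hp, hp'⟩ := H T g n w' (e ▸ jet_base_change S.base h)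
      rw [jetEval_congr (Category.assoc _ _ _).symm rfl w, ← hp']
      refine jetEval_jetVert R k S (g ≫ s) n h p
        (hp.trans (jetEval_congr e.symm rfl _)) ?_
      rw [← Category.assoc, hp']
      exact jetEval_hom _ _ _
  exact VHSpan.equivalent_of_hom hb s hs (pullback.lift_fst _ _ _)

theorem jetSpan_equivalent {X Y : CodDual 𝓑} {S S' : VHSpan X Y} (h : S.Equivalent S') :
    (jetSpan R k S).Equivalent (jetSpan R k S') := by
  obtain ⟨hb, s, h1, h2⟩ := h
  refine equivalent_jetSpan R k S' _ hb fun T g n w w' => ?_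
  obtain ⟨p, hp, -, hp'⟩ := exists_jetEval_jetVert R k S g n
    (by rw [← w, Category.assoc, ← jetVert_proj]; rfl)
  refine ⟨p ≫ s.hom, ?_, ?_⟩
  · rw [Category.assoc, h2, hp]
    exact jetEval_congr rfl (by rw [hb]) _
  · rw [Category.assoc, h1]
    exact hp'.symm

/-- The `k`-jet functor on `(𝓑²)*`. -/
noncomputable def jetFunctor : CodDual 𝓑 ⥤ CodDual 𝓑 where
  obj := jetBundle R k
  map := Quotient.map (jetSpan R k) fun _ _ => jetSpan_equivalent R k
  map_id X := by
    refine (Quotient.sound (equivalent_jetSpan R k (VHSpan.id X)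
      (VHSpan.id (jetBundle R k X)) rfl fun T g n w w' => ?_)).symm
    refine ⟨jetEval (E := Over.mk X.proj) g n
      ((congrArg (· ≫ _) (Category.comp_id g)).symm.trans w), ?_, ?_⟩
    · refine (Category.comp_id _).trans (jetEval_congr (Category.comp_id g).symm ?_ _)
      exact ((congrArg (n ≫ ·) (nbhd.map_id R k X.base)).trans (Category.comp_id _)).symm
    · exact (Category.comp_id _).trans (jetEval_congr (Category.comp_id g).symm rfl _)
  map_comp := by
    rintro X Y Z ⟨S⟩ ⟨S'⟩
    refine (Quotient.sound (equivalent_jetSpan R k (VHSpan.comp S S')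
      (VHSpan.comp (jetSpan R k S) (jetSpan R k S')) rfl fun T g n w w' => ?_)).symm
    let q : T ⟶ pullback (jetBundle R k Y).proj S.base :=
      g ≫ pullback.fst (jetSpan R k S).horiz (jetSpan R k S').vert
    let q' : T ⟶ pullback (jetBundle R k Z).proj S'.base :=
      g ≫ pullback.snd (jetSpan R k S).horiz (jetSpan R k S').vert
    have hq : q ≫ pullback.fst _ _ = q' ≫ jetVert R k S' :=
      (Category.assoc _ _ _).trans ((congrArg (g ≫ ·) (pullback.condition
        (f := (jetSpan R k S).horiz))).trans (Category.assoc _ _ _).symm)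
    have h : q ≫ pullback.snd _ _ = n ≫ nbhd.d R k X.base := by
      rw [← w, ← jetVert_proj, ← Category.assoc]
      exact congrArg (· ≫ _) (Category.assoc _ _ _)
    have h' : q' ≫ pullback.snd _ _ = (n ≫ nbhd.map R k S.base) ≫ nbhd.d R k Y.base := by
      rw [← jet_base_change S.base h, hq, Category.assoc, jetVert_proj]
    -- The intermediate jet of `Y` is the `S'`-image of a jet of `Z`. So its value at the image of
    -- `n` is both the horizontal image of `p` and the vertical image of `r`, and `(p, r)` is a
    -- point of the composite span.
    obtain ⟨p, hp, hpc, hp'⟩ := exists_jetEval_jetVert R k S q n h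
    obtain ⟨r, hr, hrc, hr'⟩ := exists_jetEval_jetVert R k S' q' _ h'
    refine ⟨pullback.lift p r ?_, ?_, ?_⟩
    · rw [hp, ← hr']
      exact jetEval_congr hq rfl _
    · refine (pullback.lift_snd_assoc _ _ _ _).trans (hr.trans (jetEval_congr ?_ ?_ _))
      · exact Category.assoc _ _ _
      · exact (Category.assoc _ _ _).trans (congrArg (n ≫ ·) (nbhd.map_comp R k _ _).symm)
    · refine (pullback.lift_fst_assoc _ _ _ _).trans (hp'.symm.trans (jetEval_congr ?_ rfl _))
      exact Category.assoc _ _ _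

theorem jetFunctor_toBase : jetFunctor R k ⋙ CodDual.toBase 𝓑 = CodDual.toBase 𝓑 :=
  CategoryTheory.Functor.ext (fun _ => rfl) (by
    rintro X Y ⟨S⟩
    exact ((Category.id_comp _).trans (Category.comp_id _)).symm)

theorem fibre_jetFunctor (A : 𝓑) :
    CodDual.fibre A ⋙ jetFunctor R k = (jet R k A).op ⋙ CodDual.fibre A :=
  -- The objects agree definitionally, so the transport arrows are identities and an equivalence of
  -- spans remains.
  CategoryTheory.Functor.ext (fun _ => rfl) fun x y f => by
    refine Eq.trans ?_ ((Category.id_comp _).trans (Category.comp_id _)).symm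
    refine (Quotient.sound ?_).symm
    refine equivalent_jetSpan R k (X := ⟨A, x.unop.left, x.unop.hom⟩)
      (Y := ⟨A, y.unop.left, y.unop.hom⟩) _ _ rfl fun T g n w w' => ?_
    refine ⟨jetEval (E := y.unop) g n
      (((congrArg (g ≫ ·) (Over.w ((jet R k A).map f.unop))).symm.trans
        (Category.assoc _ _ _).symm).trans w), ?_, ?_⟩
    · refine (Category.comp_id _).trans (jetEval_congr (Category.comp_id g).symm ?_ _)
      exact ((congrArg (n ≫ ·) (nbhd.map_id R k A)).trans (Category.comp_id _)).symm
    · exact (jetEval_map f.unop g n _).symm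

end JetFunctor

end JetBundles

/-! ### The neighbour relation in a chart -/

namespace JetBundles

/-- If all products of `k + 1` of the elements `d i` vanish, then so do those of elements of the
ideal generated by the `d i`. -/
theorem prod_eq_zero_of_mem_span {A : Type*} [CommRing A] {k n : ℕ} {d : Fin n → A}
    (hd : ∀ g : Fin (k + 1) → Fin n, ∏ j, d (g j) = 0) {r : Fin (k + 1) → A}
    (hr : ∀ j, r j ∈ Ideal.span (Set.range d)) : ∏ j, r j = 0 := by
  have h : ∏ j, r j ∈ ∏ _j : Fin (k + 1), Ideal.span (Set.range d) :=
    Ideal.prod_mem_prod fun j _ => hr j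
  -- The product of `k + 1` copies of the ideal is generated by the products of `k + 1` generators,
  -- all zero.
  rw [Ideal.prod_span, Ideal.span_eq_bot.2, Ideal.mem_bot] at h
  · exact h
  · intro x hx
    obtain ⟨g, hg, rfl⟩ := (Set.mem_fintype_prod _ _).1 hx
    choose i hi using hg
    rw [← hd i]
    exact Finset.prod_congr rfl fun j _ => (hi j).symm

section Charts

variable {𝓑 : Type u} [Category.{v} 𝓑] [CartesianMonoidalCategory 𝓑] [BraidedCategory 𝓑]
  [HasFiniteLimits 𝓑] {R : 𝓑} [CommRingObj R]

/-- The variation of functions on an infinitesimal object is infinitesimal. -/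
theorem KockLawvere.isInfinitesimal_sub (hR : KockLawvere R) {k n m : ℕ} {T : 𝓑}
    (φ : Fin m → (infinitesimal R k n ⊗ T ⟶ R)) (δ : T ⟶ infinitesimal R k n) :
    IsInfinitesimal k fun i =>
      lift δ (𝟙 T) ≫ φ i - lift (infinitesimal.zero R k n T) (𝟙 T) ≫ φ i := by
  intro g
  refine prod_eq_zero_of_mem_span (d := fun i => δ ≫ infinitesimal.coord R k n i)
    ((infinitesimal.isInfinitesimal_coord R k n).comp δ) fun j => ?_
  obtain ⟨a, ha, -⟩ := hR k n T (φ (g j))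
  have eval (ε : T ⟶ infinitesimal R k n) : lift ε (𝟙 T) ≫ φ (g j) =
      ∑ m, a m * ∏ i, (ε ≫ infinitesimal.coord R k n i) ^ (m.1 i : ℕ) := by
    rw [ha]
    change precomp R (lift ε (𝟙 T)) _ = _
    simp only [map_sum, map_mul, map_prod, map_pow]
    refine Finset.sum_congr rfl fun m _ => congrArg₂ _ ?_ (Finset.prod_congr rfl fun i _ => ?_)
    · exact (lift_snd_assoc _ _ _).trans (Category.id_comp _)
    · exact congrArg (· ^ (m.1 i : ℕ)) (lift_fst_assoc _ _ _)
  beta_reduce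
  rw [eval, eval, ← Ideal.Quotient.eq]
  have h (i : Fin n) : Ideal.Quotient.mk
      (Ideal.span (Set.range fun i => δ ≫ infinitesimal.coord R k n i))
        (δ ≫ infinitesimal.coord R k n i) = 0 :=
    Ideal.Quotient.eq_zero_iff_mem.2 (Ideal.subset_span ⟨i, rfl⟩)
  -- Modulo the coordinates of `δ`, both sides are the same polynomial evaluated at the origin.
  simp only [map_sum, map_mul, map_prod, map_pow, h, infinitesimal.zero_coord, map_zero]

omit [CartesianMonoidalCategory 𝓑] [BraidedCategory 𝓑] in
/-- Universal quantification of a subobject along an arrow. -/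
theorem exists_forall_mono [LocallyCartesianClosed 𝓑] {X Y W : 𝓑} (f : X ⟶ Y) (w : W ⟶ X)
    [Mono w] :
    ∃ (S : 𝓑) (m : S ⟶ Y), Mono m ∧ ∀ (T : 𝓑) (t : T ⟶ Y),
      (∃ s : T ⟶ S, s ≫ m = t) ↔ ∃ p : pullback t f ⟶ W, p ≫ w = pullback.snd t f := by
  let adj := Adjunction.ofIsLeftAdjoint (Over.pullback f)
  let S := (Over.pullback f).rightAdjoint.obj (Over.mk w)
  refine ⟨S.left, S.hom, ⟨fun {T} a b h => ?_⟩, fun T t => ⟨?_, ?_⟩⟩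
  · let a' : Over.mk (a ≫ S.hom) ⟶ S := Over.homMk a rfl
    let b' : Over.mk (a ≫ S.hom) ⟶ S := Over.homMk b h.symm
    suffices a' = b' from congrArg CommaMorphism.left this
    apply (adj.homEquiv _ _).symm.injective
    ext1
    -- Arrows into `Π_f w` transpose to arrows over `X` into the subobject `w`, of which there is at
    -- most one.
    rw [← cancel_mono w]
    exact (Over.w _).trans (Over.w _).symm
  · rintro ⟨s, hs⟩
    let s' : Over.mk t ⟶ S := Over.homMk s hs
    exact ⟨((adj.homEquiv _ _).symm s').left, Over.w _⟩
  · rintro ⟨p, hp⟩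
    let p' : (Over.pullback f).obj (Over.mk t) ⟶ Over.mk w := Over.homMk p hp
    exact ⟨(adj.homEquiv _ _ p').left, Over.w _⟩

/-- The object of those pairs of points of a chart whose difference, in coordinates, is in
`D_k(m)`. -/
theorem exists_infinitesimal_pairs (k : ℕ) {m : ℕ} {U : 𝓑} (e : Fin m → (U ⟶ R)) :
    ∃ (W : 𝓑) (w : W ⟶ U ⊗ U), Mono w ∧ ∀ (T : 𝓑) (x y : T ⟶ U),
      (∃ p : T ⟶ W, p ≫ w = lift x y) ↔ IsInfinitesimal k fun i => y ≫ e i - x ≫ e i := by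
  let a : U ⊗ U ⟶ ∏ᶜ fun _ : Fin (k + 1) → Fin m => R :=
    Pi.lift fun g => ∏ j, (snd U U ≫ e (g j) - fst U U ≫ e (g j))
  let b : U ⊗ U ⟶ ∏ᶜ fun _ : Fin (k + 1) → Fin m => R := Pi.lift fun _ => 0
  have ha {T : 𝓑} (x y : T ⟶ U) (g : Fin (k + 1) → Fin m) :
      (lift x y ≫ a) ≫ Pi.π _ g = ∏ j, (y ≫ e (g j) - x ≫ e (g j)) := by
    rw [Category.assoc, Pi.lift_π]
    change precomp R (lift x y) _ = _
    rw [map_prod]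
    refine Finset.prod_congr rfl fun j _ => (map_sub _ _ _).trans (congrArg₂ _ ?_ ?_)
    · exact lift_snd_assoc _ _ _
    · exact lift_fst_assoc _ _ _
  have hb {T : 𝓑} (x y : T ⟶ U) (g : Fin (k + 1) → Fin m) :
      (lift x y ≫ b) ≫ Pi.π _ g = 0 := by
    rw [Category.assoc, Pi.lift_π]
    exact map_zero (precomp R (lift x y))
  refine ⟨equalizer a b, equalizer.ι a b, inferInstance, fun T x y => ⟨?_, fun h => ?_⟩⟩
  · rintro ⟨p, hp⟩ g
    rw [← ha, ← hb x y g, ← hp]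
    simp only [Category.assoc, equalizer.condition_assoc]
  · exact ⟨equalizer.lift (lift x y) (Pi.hom_ext _ _ fun g => by rw [ha, hb]; exact h g),
      equalizer.lift_ι _ _⟩

variable [MonoidalClosed 𝓑] [HasImages 𝓑] [HasCoproductsOfShape ℕ 𝓑]

/-- A point of the image `M_(k)` is not lifted to a figure. Instead `M_(k)` is shown to lie in a
subobject of `M × M` expressing the conclusion for all `x` at once. -/
theorem IsNeighbour.exists_of_chart [LocallyCartesianClosed 𝓑] (hR : KockLawvere R) {k : ℕ}
    {M : 𝓑} (φ : FormalChart R M) {T : 𝓑} {x : T ⟶ φ.dom} {y : T ⟶ M}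
    (h : IsNeighbour R k (x ≫ φ.incl) y) :
    ∃ y' : T ⟶ φ.dom, y' ≫ φ.incl = y ∧
      IsInfinitesimal k fun i : Fin φ.dim =>
        y' ≫ φ.coords ≫ Pi.π _ i - x ≫ φ.coords ≫ Pi.π _ i := by
  have := φ.mono_incl
  obtain ⟨W, w, _, hW⟩ := exists_infinitesimal_pairs k fun i : Fin φ.dim =>
    φ.coords ≫ Pi.π (fun _ => R) i
  have : Mono (φ.dom ◁ φ.incl) := ⟨fun a b hab => by
    apply CartesianMonoidalCategory.hom_ext
    · simpa using congrArg (· ≫ fst _ _) hab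
    · rw [← cancel_mono φ.incl]
      simpa using congrArg (· ≫ snd _ _) hab⟩
  -- `S` consists of the `(a, b)` such that every `x` in the chart lying over `a` has a `y'` over
  -- `b` with `(x, y')` in `W`.
  obtain ⟨S, m, _, hS⟩ := exists_forall_mono (φ.incl ▷ M) (w ≫ φ.dom ◁ φ.incl)
  obtain ⟨l, hl⟩ := exists_nbhd_lift R k m fun n => (hS _ _).2 (by
    let D := infinitesimal R k n
    let t : D ⊗ (ihom D).obj M ⟶ M ⊗ M :=
      lift (lift (infinitesimal.zero R k n _) (snd _ _) ≫ (ihom.ev D).app M) ((ihom.ev D).app M)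
    let p := pullback.fst t (φ.incl ▷ M)
    let q := pullback.snd t (φ.incl ▷ M)
    have hpq : p ≫ t = q ≫ φ.incl ▷ M := pullback.condition
    let f : D ⊗ pullback t (φ.incl ▷ M) ⟶ M := D ◁ (p ≫ snd _ _) ≫ (ihom.ev D).app M
    have hf (ε : pullback t (φ.incl ▷ M) ⟶ D) :
        lift ε (𝟙 _) ≫ f = lift ε (p ≫ snd _ _) ≫ (ihom.ev D).app M := by
      rw [← Category.assoc]
      congr 1
      simp
    have h0 : lift (infinitesimal.zero R k n _) (𝟙 _) ≫ f = (q ≫ fst _ _) ≫ φ.incl := by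
      have := congrArg (· ≫ fst _ _) hpq
      simp only [Category.assoc, t, lift_fst, whiskerRight_fst] at this
      rw [hf, Category.assoc, ← this, ← Category.assoc, comp_lift, infinitesimal.comp_zero]
    have h1 : lift (p ≫ fst _ _) (𝟙 _) ≫ f = q ≫ snd _ _ := by
      have := congrArg (· ≫ snd _ _) hpq
      simp only [Category.assoc, t, lift_snd, whiskerRight_snd] at this
      rw [hf, ← this, ← comp_lift, lift_fst_snd, Category.comp_id]
    -- The figure `f` starts at the chart point `q ≫ fst`, so it lifts to a figure `g` in the chart;
    -- the required `y'` is the value of `g` at the given element of `D_k(n)`.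
    obtain ⟨g, ⟨hg, hg'⟩, -⟩ := φ.etale_incl k n _ _ f h0
    obtain ⟨r, hr⟩ := (hW _ (q ≫ fst _ _) (lift (p ≫ fst _ _) (𝟙 _) ≫ g)).2 (by
      have := hR.isInfinitesimal_sub (fun i => g ≫ φ.coords ≫ Pi.π (fun _ => R) i) (p ≫ fst _ _)
      simpa only [reassoc_of% hg', ← Category.assoc] using this)
    refine ⟨r, ?_⟩
    rw [reassoc_of% hr]
    change _ = q
    apply CartesianMonoidalCategory.hom_ext
    · simp
    · simp [hg, h1])
  obtain ⟨z, hz⟩ := h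
  obtain ⟨p, hp⟩ := (hS T (lift (x ≫ φ.incl) y)).1 ⟨z ≫ l, by rw [Category.assoc, hl, hz]⟩
  -- This specializes the universal quantifier in `S` to the given `x`.
  let s : T ⟶ pullback (lift (x ≫ φ.incl) y) (φ.incl ▷ M) :=
    pullback.lift (𝟙 T) (lift x y) (by simp)
  have hs : (s ≫ p ≫ w) ≫ φ.dom ◁ φ.incl = lift x y := by
    rw [Category.assoc, Category.assoc, hp]
    exact pullback.lift_snd _ _ _
  refine ⟨(s ≫ p ≫ w) ≫ snd _ _, ?_, (hW T x _).1 ⟨s ≫ p, ?_⟩⟩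
  · simpa using congrArg (· ≫ snd _ _) hs
  · rw [Category.assoc]
    apply CartesianMonoidalCategory.hom_ext
    · simpa using congrArg (· ≫ fst _ _) hs
    · simp

/-- The figure `d ↦ e x + d` in coordinates starts at `e x`, so it lifts to a figure in the chart
starting at `x`. At `δ = e y - e x` the lift equals `y` because `e` is mono; its image in `M` joins
the two points. -/
theorem isNeighbour_of_chart {k : ℕ} {M : 𝓑} (φ : FormalChart R M) {T : 𝓑}
    {x y : T ⟶ φ.dom}
    (h : IsInfinitesimal k fun i : Fin φ.dim =>
      y ≫ φ.coords ≫ Pi.π _ i - x ≫ φ.coords ≫ Pi.π _ i) :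
    IsNeighbour R k (x ≫ φ.incl) (y ≫ φ.incl) := by
  have := φ.mono_coords
  obtain ⟨δ, hδ⟩ := h.exists_lift
  let f : infinitesimal R k φ.dim ⊗ T ⟶ affineSpace R φ.dim := Pi.lift fun i =>
    fst _ _ ≫ infinitesimal.coord R k φ.dim i + snd _ _ ≫ x ≫ φ.coords ≫ Pi.π _ i
  have hf (ε : T ⟶ infinitesimal R k φ.dim) (i : Fin φ.dim) :
      (lift ε (𝟙 T) ≫ f) ≫ Pi.π _ i =
        ε ≫ infinitesimal.coord R k φ.dim i + x ≫ φ.coords ≫ Pi.π _ i := by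
    rw [Category.assoc, Pi.lift_π]
    refine (map_add (precomp R (lift ε (𝟙 T))) _ _).trans (congrArg₂ _ ?_ ?_)
    · exact lift_fst_assoc _ _ _
    · exact (lift_snd_assoc _ _ _).trans (Category.id_comp _)
  obtain ⟨g, ⟨hg, hg'⟩, -⟩ := φ.etale_coords k φ.dim T x f (Pi.hom_ext _ _ fun i => by
    rw [hf, infinitesimal.zero_coord, zero_add, Category.assoc])
  have hy : lift δ (𝟙 T) ≫ g = y := by
    rw [← cancel_mono φ.coords, Category.assoc, hg]
    refine Pi.hom_ext _ _ fun i => ?_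
    rw [hf, hδ, sub_add_cancel, Category.assoc]
  have key := isNeighbour_endpoints R k φ.dim (g ≫ φ.incl) δ
  rwa [reassoc_of% hg', reassoc_of% hy] at key

end Charts

end JetBundles

theorem mainTheorem5 {𝓑 : Type u} [Category.{v} 𝓑] [CartesianMonoidalCategory 𝓑]
    [BraidedCategory 𝓑] [HasFiniteLimits 𝓑] [HasImages 𝓑] [HasCoproductsOfShape ℕ 𝓑]
    [MonoidalClosed 𝓑] [JetBundles.LocallyCartesianClosed 𝓑]
    (R : 𝓑) [CommRingObj R] (hR : JetBundles.KockLawvere R) (k : ℕ) :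
    (∃ J : JetBundles.CodDual 𝓑 ⥤ JetBundles.CodDual 𝓑,
      J ⋙ JetBundles.CodDual.toBase 𝓑 = JetBundles.CodDual.toBase 𝓑 ∧
      ∀ A : 𝓑, JetBundles.CodDual.fibre A ⋙ J =
        (JetBundles.jet R k A).op ⋙ JetBundles.CodDual.fibre A) ∧
    (∀ (M : 𝓑) (φ : JetBundles.FormalChart R M) (T : 𝓑) (x : T ⟶ φ.dom) (y : T ⟶ M),
      JetBundles.IsNeighbour R k (x ≫ φ.incl) y ↔
        ∃ y' : T ⟶ φ.dom, y' ≫ φ.incl = y ∧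
          JetBundles.IsInfinitesimal (R := R) k fun i : Fin φ.dim =>
            y' ≫ φ.coords ≫ Pi.π _ i - x ≫ φ.coords ≫ Pi.π _ i) := by
  refine ⟨⟨JetBundles.jetFunctor R k, JetBundles.jetFunctor_toBase R k,
    JetBundles.fibre_jetFunctor R k⟩, fun M φ T x y => ⟨fun h => h.exists_of_chart hR, ?_⟩⟩
  rintro ⟨y', rfl, h⟩
  exact JetBundles.isNeighbour_of_chart φ h
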